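/- \textbf{Definitions.} A \emph{non-degenerate braided set} is a pair $(X,R)$ of a set $X$ and a bijection $R:X\times X\to X\times X$, $R(x,y)=(\varphi_x(y),\psi_y(x))$, with $R_{12}R_{23}R_{12}=R_{23}R_{12}R_{23}$ on $X^3$ (where $R_{12}=R\times\mathrm{id}$, $R_{23}=\mathrm{id}\times R$) such that all maps $\varphi_x,\psi_y:X\to X$ are bijective. A morphism $(X,R)\to(X',R')$ is a map $f:X\to X'$ with $(f\times f)R=R'(f\times f)$. Let $\mathrm{BS}$ be the resulting category. A \emph{braided group} is a group $G$ with a map $\sigma:G\times G\to G\times G$, $\sigma(a,b)=(a\rightharpoonup b,\ a\leftharpoonup b)$, such that for all $a,b,h,k\in G$: $e\rightharpoonup h=h$; $a\rightharpoonup(b\rightharpoonup h)=(ab)\rightharpoonup h$; $(ab)\leftharpoonup h=(a\leftharpoonup(b\rightharpoonup h))(b\leftharpoonup h)$; $a\leftharpoonup e=a$; $(a\leftharpoonup h)\leftharpoonup k=a\leftharpoonup(hk)$; $a\rightharpoonup(hk)=(a\rightharpoonup h)((a\leftharpoonup h)\rightharpoonup k)$; and $(a\rightharpoonup b)(a\leftharpoonup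 b)=ab$. Morphisms are the group homomorphisms $f$ with $(f\times f)\sigma=\sigma'(f\times f)$. Let $\mathrm{BG}$ be the resulting category. A \emph{post-group} is a group $(G,\cdot)$ with an operation $\rhd$ on $G$ such that each map $b\mapsto a\rhd b$ is an automorphism of $(G,\cdot)$ and $(a\cdot(a\rhd b))\rhd c=a\rhd(b\rhd c)$ for all $a,b,c\in G$. Morphisms are the maps that preserve $\cdot$ and $\rhd$. Let $\mathrm{PG}$ be the resulting category. \textbf{Functors.} \begin{itemize} \item $\mathcal Y:\mathrm{PG}\to\mathrm{BG}$ sends $(G,\cdot,\rhd)$ to the group $(G,\circ)$ with $a\circ b=a\cdot(a\rhd b)$, whose inverse map is written $a\mapsto a^\dagger$, together with $R_G(a,b)=\big(a\rhd b,\ (a\rhd b)^\dagger\circ a\circ b\big)$, and is the identity on underlying maps of morphisms. \item $\mathcal P:\mathrm{BG}\to\mathrm{PG}$ sends $((G,\circ),\sigma)$ to $(G,\cdot,\rhd)$ with $a\rhd b=a\rightharpoonup b$ and $a\cdot b=a\circ(a^\dagger\rightharpoonup b)$, where $a^\dagger$ is the inverse of $a$ in $(G,\circ)$, and is the identity on underlying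 maps of morphisms. \item $\mathcal U:\mathrm{BG}\to\mathrm{BS}$ forgets the group structure and keeps $\sigma$. \item $\mathcal F:\mathrm{BS}\to\mathrm{BG}$ is the structure group functor. It sends $(X,R)$ to the group $G_X$ generated by $X$ with the relations $xy=uv$ whenever $R(x,y)=(u,v)$, equipped with the unique braided group structure $\bar R$ for which the canonical map $\iota_X:X\to G_X$ satisfies $\bar R(\iota_X\times\iota_X)=(\iota_X\times\iota_X)R$. It sends a morphism $f:X\to X'$ to the induced homomorphism $G_X\to G_{X'}$, $\iota_X(x)\mapsto\iota_{X'}(f(x))$. \end{itemize} \textbf{Theorem.} The functor $\mathcal P\circ\mathcal F:\mathrm{BS}\to\mathrm{PG}$ is left adjoint to the functor $\mathcal U\circ\mathcal Y:\mathrm{PG}\to\mathrm{BS}$. -/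

import Mathlib

open CategoryTheory

universe u

namespace BraidedPost

/-! ### Non-degenerate braided sets -/

/-- `R₁₂ = R × id` on `X × X × X`. -/
def braid12 {X : Type u} (R : X × X → X × X) : X × X × X → X × X × X :=
  fun t => ((R (t.1, t.2.1)).1, (R (t.1, t.2.1)).2, t.2.2)

/-- `R₂₃ = id × R` on `X × X × X`. -/
def braid23 {X : Type u} (R : X × X → X × X) : X × X × X → X × X × X :=
  fun t => (t.1, R (t.2.1, t.2.2))

/-- A set-theoretical solution of the Yang-Baxter equation: a bijection `R` of `X × X` with
`R₁₂ R₂₃ R₁₂ = R₂₃ R₁₂ R₂₃`. -/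
structure IsYangBaxter {X : Type u} (R : X × X → X × X) : Prop where
  bijective : Function.Bijective R
  braid : braid12 R ∘ braid23 R ∘ braid12 R = braid23 R ∘ braid12 R ∘ braid23 R

/-- Writing `R (x, y) = (φ_x y, ψ_y x)`, all the maps `φ_x` and `ψ_y` are bijective. -/
structure IsNondegenerate {X : Type u} (R : X × X → X × X) : Prop where
  left : ∀ x, Function.Bijective (fun y => (R (x, y)).1)
  right : ∀ y, Function.Bijective (fun x => (R (x, y)).2)

/-- Non-degenerate braided sets. -/
structure BraidedSet : Type (u + 1) where
  carrier : Type u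
  R : carrier × carrier → carrier × carrier
  yangBaxter : IsYangBaxter R
  nondegenerate : IsNondegenerate R

/-- Homomorphisms of braided sets. -/
@[ext]
structure BraidedSet.Hom (X Y : BraidedSet.{u}) : Type u where
  toFun : X.carrier → Y.carrier
  comm : Prod.map toFun toFun ∘ X.R = Y.R ∘ Prod.map toFun toFun

instance : Category.{u} BraidedSet.{u} where
  Hom := BraidedSet.Hom
  id X := ⟨id, rfl⟩
  comp {X Y Z} f g := ⟨g.toFun ∘ f.toFun, by
    rw [← Prod.map_comp_map, Function.comp_assoc, f.comm, ← Function.comp_assoc, g.comm,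
      Function.comp_assoc]⟩

/-! ### Braided groups -/

/-- A matched pair of groups `(G, H, σ)`, where `σ (a, h) = (a ⇀ h, a ↼ h)`. -/
structure IsMatchedPair {G H : Type u} [Group G] [Group H] (σ : G × H → H × G) : Prop where
  one_left : ∀ h, (σ (1, h)).1 = h
  left_left : ∀ a b h, (σ (a, (σ (b, h)).1)).1 = (σ (a * b, h)).1
  mul_right : ∀ a b h, (σ (a * b, h)).2 = (σ (a, (σ (b, h)).1)).2 * (σ (b, h)).2
  right_one : ∀ a, (σ (a, 1)).2 = a
  right_right : ∀ a h k, (σ ((σ (a, h)).2, k)).2 = (σ (a, h * k)).2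
  left_mul : ∀ a h k, (σ (a, h * k)).1 = (σ (a, h)).1 * (σ ((σ (a, h)).2, k)).1

/-- A braiding on a group `G`. -/
structure IsBraiding {G : Type u} [Group G] (σ : G × G → G × G) : Prop where
  matched : IsMatchedPair σ
  mul_eq : ∀ a b, (σ (a, b)).1 * (σ (a, b)).2 = a * b

/-- Braided groups. -/
structure BraidedGroup : Type (u + 1) where
  carrier : Type u
  [group : Group carrier]
  σ : carrier × carrier → carrier × carrier
  braiding : IsBraiding σ

attribute [instance] BraidedGroup.group

/-- Homomorphisms of braided groups. -/
@[ext]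
structure BraidedGroup.Hom (G H : BraidedGroup.{u}) : Type u where
  toHom : G.carrier →* H.carrier
  comm : Prod.map toHom toHom ∘ G.σ = H.σ ∘ Prod.map toHom toHom

instance : Category.{u} BraidedGroup.{u} where
  Hom := BraidedGroup.Hom
  id G := ⟨MonoidHom.id _, rfl⟩
  comp {G H K} f g := ⟨g.toHom.comp f.toHom, by
    rw [MonoidHom.coe_comp, ← Prod.map_comp_map, Function.comp_assoc, f.comm,
      ← Function.comp_assoc, g.comm, Function.comp_assoc]⟩

/-! ### Post-groups -/

/-- Post-groups: a group with a second operation `a ▷ b`, written `rhd a b`, such that every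
`rhd a` is an automorphism of the group and `(a * (a ▷ b)) ▷ c = a ▷ (b ▷ c)`. -/
structure PostGroup : Type (u + 1) where
  carrier : Type u
  [group : Group carrier]
  rhd : carrier → carrier → carrier
  rhd_bijective : ∀ a, Function.Bijective (rhd a)
  rhd_mul : ∀ a b c, rhd a (b * c) = rhd a b * rhd a c
  rhd_rhd : ∀ a b c, rhd (a * rhd a b) c = rhd a (rhd b c)

attribute [instance] PostGroup.group

/-- Homomorphisms of post-groups. -/
@[ext]
structure PostGroup.Hom (G H : PostGroup.{u}) : Type u where
  toFun : G.carrier → H.carrier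
  map_mul : ∀ a b, toFun (a * b) = toFun a * toFun b
  map_rhd : ∀ a b, toFun (G.rhd a b) = H.rhd (toFun a) (toFun b)

instance : Category.{u} PostGroup.{u} where
  Hom := PostGroup.Hom
  id G := ⟨id, fun _ _ => rfl, fun _ _ => rfl⟩
  comp {G H K} f g := ⟨g.toFun ∘ f.toFun, fun a b => by simp [f.map_mul, g.map_mul],
    fun a b => by simp [f.map_rhd, g.map_rhd]⟩

/-! ### The functor from post-groups to braided groups -/

/-- The group with the given product, unit and inverse. -/
@[reducible]
def mkGroup {G : Type u} (mul : G → G → G) (one : G) (inv : G → G)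
    (mul_assoc : ∀ a b c, mul (mul a b) c = mul a (mul b c)) (one_mul : ∀ a, mul one a = a)
    (inv_mul : ∀ a, mul (inv a) a = one) : Group G :=
  letI : Mul G := ⟨mul⟩
  letI : One G := ⟨one⟩
  letI : Inv G := ⟨inv⟩
  Group.ofLeftAxioms mul_assoc one_mul inv_mul

namespace PostGroup

variable (G : PostGroup.{u})

theorem rhd_one (a : G.carrier) : G.rhd a 1 = 1 := by
  have h := G.rhd_mul a 1 1
  rw [mul_one] at h
  exact left_eq_mul.mp h

theorem one_rhd (a : G.carrier) : G.rhd 1 a = a := by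
  have h := G.rhd_rhd 1 1 a
  rw [G.rhd_one, mul_one] at h
  exact ((G.rhd_bijective 1).1 h).symm

/-- The sub-adjacent product `a ∘ b = a * (a ▷ b)`. -/
def circ (a b : G.carrier) : G.carrier := a * G.rhd a b

/-- The inverse `a† = (rhd a)⁻¹ a⁻¹` for the sub-adjacent product. -/
noncomputable def dagger (a : G.carrier) : G.carrier :=
  (Equiv.ofBijective (G.rhd a) (G.rhd_bijective a)).symm a⁻¹

theorem rhd_dagger (a : G.carrier) : G.rhd a (G.dagger a) = a⁻¹ :=
  Equiv.ofBijective_apply_symm_apply (G.rhd a) (G.rhd_bijective a) a⁻¹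

theorem circ_assoc (a b c : G.carrier) :
    G.circ (G.circ a b) c = G.circ a (G.circ b c) := by
  simp only [circ, G.rhd_rhd, G.rhd_mul, mul_assoc]

theorem circ_one (a : G.carrier) : G.circ a 1 = a := by simp [circ, rhd_one]

theorem one_circ (a : G.carrier) : G.circ 1 a = a := by simp [circ, one_rhd]

theorem circ_dagger (a : G.carrier) : G.circ a (G.dagger a) = 1 := by
  simp [circ, rhd_dagger]

theorem dagger_circ (a : G.carrier) : G.circ (G.dagger a) a = 1 := by
  have h := G.circ_dagger (G.dagger a)
  have h2 : G.dagger (G.dagger a) = a := by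
    rw [← G.one_circ (G.dagger (G.dagger a)), ← G.circ_dagger a, G.circ_assoc, h, G.circ_one]
  rwa [h2] at h

/-- The sub-adjacent group `(G, ∘)`. -/
@[reducible]
noncomputable def subAdjacent : Group G.carrier :=
  mkGroup G.circ 1 G.dagger G.circ_assoc G.one_circ G.dagger_circ

/-- `R_G (a, b) = (a ▷ b, (a ▷ b)† ∘ a ∘ b)`. -/
noncomputable def braiding (p : G.carrier × G.carrier) : G.carrier × G.carrier :=
  (G.rhd p.1 p.2, G.circ (G.circ (G.dagger (G.rhd p.1 p.2)) p.1) p.2)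

theorem rhd_circ (a b c : G.carrier) :
    G.rhd a (G.circ b c) =
      G.circ (G.rhd a b) (G.rhd (G.circ (G.circ (G.dagger (G.rhd a b)) a) b) c) := by
  have h : G.rhd (G.rhd a b) (G.rhd (G.circ (G.circ (G.dagger (G.rhd a b)) a) b) c) =
      G.rhd a (G.rhd b c) := by
    rw [← G.rhd_rhd, ← G.rhd_rhd]
    change G.rhd (G.circ _ _) c = G.rhd (G.circ _ _) c
    rw [G.circ_assoc, ← G.circ_assoc, G.circ_dagger, G.one_circ]
  rw [circ, G.rhd_mul, ← h]; rfl

theorem isBraiding : @IsBraiding G.carrier G.subAdjacent G.braiding := by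
  let _ := G.subAdjacent
  have key : ∀ a b : G.carrier, G.braiding (a, b) = (G.rhd a b, (G.rhd a b)⁻¹ * a * b) :=
    fun _ _ => rfl
  have hact : ∀ a b c : G.carrier, G.rhd a (G.rhd b c) = G.rhd (a * b) c :=
    fun a b c => (G.rhd_rhd a b c).symm
  have hmul : ∀ a b c : G.carrier, G.rhd a (b * c) =
      G.rhd a b * G.rhd ((G.rhd a b)⁻¹ * a * b) c := G.rhd_circ
  refine ⟨⟨?_, ?_, ?_, ?_, ?_, ?_⟩, ?_⟩
  · exact G.one_rhd
  · intro a b h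
    simp only [key, hact]
  · intro a b h
    simp only [key, hact]
    group
  · intro a
    simp only [key]
    have : G.rhd a (1 : G.carrier) = 1 := G.rhd_one a
    rw [this]; group
  · intro a h k
    simp only [key]
    rw [hmul a h k]
    group
  · intro a h k
    simp only [key]
    exact hmul a h k
  · intro a b
    simp only [key]
    group

theorem Hom.map_circ {G H : PostGroup.{u}} (f : PostGroup.Hom G H) (a b : G.carrier) :
    f.toFun (G.circ a b) = H.circ (f.toFun a) (f.toFun b) := by
  simp [circ, f.map_mul, f.map_rhd]

/-- A homomorphism of post-groups as a homomorphism of sub-adjacent groups. -/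
@[reducible]
noncomputable def Hom.subAdjacentHom {G H : PostGroup.{u}} (f : PostGroup.Hom G H) :
    letI := G.subAdjacent
    letI := H.subAdjacent
    G.carrier →* H.carrier :=
  letI := G.subAdjacent
  letI := H.subAdjacent
  MonoidHom.mk' f.toFun f.map_circ

end PostGroup

/-- The functor from post-groups to braided groups: `(G, ·, ▷) ↦ ((G, ∘), R_G)`. -/
noncomputable def postToBraided : PostGroup.{u} ⥤ BraidedGroup.{u} where
  obj G :=
    letI := G.subAdjacent
    { carrier := G.carrier, group := G.subAdjacent, σ := G.braiding, braiding := G.isBraiding }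
  map {G H} f :=
    { toHom := PostGroup.Hom.subAdjacentHom f
      comm := by
        let _ := G.subAdjacent
        let _ := H.subAdjacent
        let F : G.carrier →* H.carrier := PostGroup.Hom.subAdjacentHom f
        funext p
        have hr : ∀ a b, F (G.rhd a b) = H.rhd (F a) (F b) := f.map_rhd
        have h2 : F ((G.rhd p.1 p.2)⁻¹ * p.1 * p.2) =
            (H.rhd (F p.1) (F p.2))⁻¹ * F p.1 * F p.2 := by
          rw [map_mul, map_mul, map_inv, hr]
        exact Prod.ext (hr p.1 p.2) h2 }
  map_id _ := rfl
  map_comp _ _ := rfl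

/-! ### The functor from braided groups to post-groups -/

namespace BraidedGroup

variable (G : BraidedGroup.{u})

/-- `a ⇀ b`. -/
def lact (a b : G.carrier) : G.carrier := (G.σ (a, b)).1

/-- `a ↼ b`. -/
def ract (a b : G.carrier) : G.carrier := (G.σ (a, b)).2

variable {G} (a b c : G.carrier)

theorem one_lact : G.lact 1 a = a := G.braiding.matched.one_left a

theorem lact_lact : G.lact a (G.lact b c) = G.lact (a * b) c :=
  G.braiding.matched.left_left a b c

theorem mul_ract : G.ract (a * b) c = G.ract a (G.lact b c) * G.ract b c :=
  G.braiding.matched.mul_right a b c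

theorem ract_one : G.ract a 1 = a := G.braiding.matched.right_one a

theorem ract_ract : G.ract (G.ract a b) c = G.ract a (b * c) :=
  G.braiding.matched.right_right a b c

theorem lact_mul : G.lact a (b * c) = G.lact a b * G.lact (G.ract a b) c :=
  G.braiding.matched.left_mul a b c

theorem lact_mul_ract : G.lact a b * G.ract a b = a * b := G.braiding.mul_eq a b

theorem lact_one : G.lact a 1 = 1 := by
  have h := lact_mul a 1 1
  rw [mul_one, ract_one] at h
  exact left_eq_mul.mp h

theorem one_ract : G.ract 1 a = 1 := by
  have h := lact_mul_ract 1 a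
  rw [one_lact, one_mul] at h
  exact mul_eq_left.mp h

theorem inv_lact_lact : G.lact a⁻¹ (G.lact a b) = b := by
  rw [lact_lact, inv_mul_cancel, one_lact]

theorem lact_inv_lact : G.lact a (G.lact a⁻¹ b) = b := by
  rw [lact_lact, mul_inv_cancel, one_lact]

theorem lact_injective : Function.Injective (G.lact a) :=
  Function.LeftInverse.injective (inv_lact_lact a)

/-- The product `a · b = a ∘ (a† ⇀ b)`. -/
def dot (a b : G.carrier) : G.carrier := a * G.lact a⁻¹ b

theorem lact_dot : G.lact a (dot b c) = dot (G.lact a b) (G.lact a c) := by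
  rw [dot, dot, lact_mul]
  congr 1
  apply lact_injective (G.lact a b)
  rw [lact_inv_lact, lact_lact, lact_mul_ract, ← lact_lact, lact_inv_lact]

theorem dot_lact : dot a (G.lact a b) = a * b := by
  rw [dot, inv_lact_lact]

theorem dot_assoc : dot (dot a b) c = dot a (dot b c) := by
  obtain ⟨b', rfl⟩ : ∃ b', G.lact a b' = b := ⟨_, lact_inv_lact a b⟩
  obtain ⟨c', rfl⟩ : ∃ c', G.lact (a * b') c' = c := ⟨_, lact_inv_lact _ c⟩
  rw [dot_lact, dot_lact, ← lact_lact, ← lact_dot, dot_lact, dot_lact, mul_assoc]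

variable (G) in
/-- The group `(G, ·)` of a braided group `(G, ∘)`. -/
@[reducible]
def dotGroup : Group G.carrier :=
  mkGroup dot 1 (fun a => G.lact a a⁻¹) dot_assoc
    (fun a => by rw [dot, inv_one, one_lact, one_mul])
    (fun a => by
      have h : G.lact a⁻¹ (dot (G.lact a a⁻¹) a) = G.lact a⁻¹ 1 := by
        rw [lact_dot, inv_lact_lact, dot_lact, inv_mul_cancel, lact_one]
      exact lact_injective _ h)

end BraidedGroup

/-- The functor from braided groups to post-groups: `a ▷ b = a ⇀ b`, `a · b = a ∘ (a† ⇀ b)`. -/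
def braidedToPost : BraidedGroup.{u} ⥤ PostGroup.{u} where
  obj G :=
    { carrier := G.carrier
      group := G.dotGroup
      rhd := G.lact
      rhd_bijective := fun a => ⟨BraidedGroup.lact_injective a,
        fun b => ⟨_, BraidedGroup.lact_inv_lact a b⟩⟩
      rhd_mul := BraidedGroup.lact_dot
      rhd_rhd := fun a b c => by
        change G.lact (BraidedGroup.dot a (G.lact a b)) c = _
        rw [BraidedGroup.dot_lact, BraidedGroup.lact_lact] }
  map {G H} f :=
    have h : ∀ a b, f.toHom (G.lact a b) = H.lact (f.toHom a) (f.toHom b) :=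
      fun a b => congrArg Prod.fst (congrFun f.comm (a, b))
    { toFun := f.toHom
      map_mul := fun a b => by
        change f.toHom (a * G.lact a⁻¹ b) = f.toHom a * H.lact (f.toHom a)⁻¹ (f.toHom b)
        rw [map_mul, h, map_inv]
      map_rhd := h }
  map_id _ := rfl
  map_comp _ _ := rfl

/-! ### The forgetful functor from braided groups to non-degenerate braided sets -/

namespace BraidedGroup

variable {G : BraidedGroup.{u}}

theorem inv_ract_lact (a b : G.carrier) : G.ract a⁻¹ (G.lact a b) = (G.ract a b)⁻¹ := by
  have h := mul_ract a⁻¹ a b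
  rw [inv_mul_cancel, one_ract] at h
  exact eq_inv_of_mul_eq_one_left h.symm

theorem ract_inv_ract (a b : G.carrier) : G.ract (G.ract a b⁻¹) b = a := by
  rw [ract_ract, inv_mul_cancel, ract_one]

theorem ract_ract_inv (a b : G.carrier) : G.ract (G.ract a b) b⁻¹ = a := by
  rw [ract_ract, mul_inv_cancel, ract_one]

theorem isYangBaxter : IsYangBaxter G.σ where
  bijective := by
    constructor
    · rintro ⟨a, b⟩ ⟨a', b'⟩ h
      have h1 : G.lact a b = G.lact a' b' := congrArg Prod.fst h
      have h2 : G.ract a b = G.ract a' b' := congrArg Prod.snd h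
      have h3 : a = a' := by
        rw [← inv_inj, ← ract_ract_inv a⁻¹ (G.lact a b), ← ract_ract_inv a'⁻¹ (G.lact a b),
          inv_ract_lact, h1, inv_ract_lact, h2]
      subst h3
      rw [lact_injective a h1]
    · rintro ⟨c, d⟩
      let a := (G.ract d⁻¹ c⁻¹)⁻¹
      have h1 : G.lact a (G.lact a⁻¹ c) = c := lact_inv_lact a c
      refine ⟨(a, G.lact a⁻¹ c), Prod.ext h1 ?_⟩
      change G.ract a (G.lact a⁻¹ c) = d
      rw [← inv_inj, ← inv_ract_lact, h1, inv_inv, ract_inv_ract]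
  braid := by
    funext ⟨x, y, z⟩
    have e1 : G.lact (G.lact x y) (G.lact (G.ract x y) z) = G.lact x (G.lact y z) := by
      rw [lact_lact, lact_lact, lact_mul_ract]
    have e3 : G.ract (G.ract x y) z = G.ract (G.ract x (G.lact y z)) (G.ract y z) := by
      rw [ract_ract, ract_ract, lact_mul_ract]
    have e2 : G.ract (G.lact x y) (G.lact (G.ract x y) z) =
        G.lact (G.ract x (G.lact y z)) (G.ract y z) := by
      have p1 := lact_mul_ract (G.lact x y) (G.lact (G.ract x y) z)
      have p2 := lact_mul_ract (G.ract x (G.lact y z)) (G.ract y z)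
      have q1 : G.lact x y * G.lact (G.ract x y) z * G.ract (G.ract x y) z = x * y * z := by
        rw [mul_assoc, lact_mul_ract, ← mul_assoc, lact_mul_ract]
      have q2 : G.lact x (G.lact y z) * (G.ract x (G.lact y z) * G.ract y z) = x * y * z := by
        rw [← mul_assoc, lact_mul_ract, mul_assoc, lact_mul_ract, mul_assoc]
      rw [← p1, ← q2, ← p2, e1, e3, mul_assoc] at q1
      exact mul_right_cancel (mul_left_cancel q1)
    exact Prod.ext e1 (Prod.ext e2 e3)

theorem isNondegenerate : IsNondegenerate G.σ where
  left x := ⟨lact_injective x, fun b => ⟨_, lact_inv_lact x b⟩⟩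
  right y := ⟨Function.LeftInverse.injective (g := fun a => G.ract a y⁻¹)
    (fun a => ract_ract_inv a y), fun b => ⟨_, ract_inv_ract b y⟩⟩

end BraidedGroup

/-- The forgetful functor from braided groups to non-degenerate braided sets. -/
def forgetBraided : BraidedGroup.{u} ⥤ BraidedSet.{u} where
  obj G := ⟨G.carrier, G.σ, BraidedGroup.isYangBaxter, BraidedGroup.isNondegenerate⟩
  map f := ⟨f.toHom, f.comm⟩
  map_id _ := rfl
  map_comp _ _ := rfl

/-! ### The structure group of a non-degenerate braided set -/

namespace BraidedSet

variable (X : BraidedSet.{u})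

/-- `φ_x y`, also written `x ⇀ y`. -/
def lact (x y : X.carrier) : X.carrier := (X.R (x, y)).1

/-- `ψ_y x`, also written `x ↼ y`. -/
def ract (x y : X.carrier) : X.carrier := (X.R (x, y)).2

/-- The structure group `G_X = ⟨X | xy = uv whenever R (x, y) = (u, v)⟩`. -/
abbrev StructureGroup : Type u :=
  PresentedGroup {r : FreeGroup X.carrier | ∃ x y u v : X.carrier, X.R (x, y) = (u, v) ∧
    r = FreeGroup.of x * FreeGroup.of y * (FreeGroup.of u * FreeGroup.of v)⁻¹}

/-- The canonical map `X → G_X`. -/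
def ι (x : X.carrier) : X.StructureGroup := PresentedGroup.of x

variable {X}

theorem ι_mul (x y : X.carrier) : X.ι x * X.ι y = X.ι (X.lact x y) * X.ι (X.ract x y) := by
  rw [← mul_inv_eq_one]
  exact PresentedGroup.one_of_mem ⟨x, y, _, _, rfl, rfl⟩

/-- The homomorphism out of `G_X` given by a map on `X` that respects the relations. -/
def lift {H : Type*} [Group H] (f : X.carrier → H)
    (hf : ∀ x y, f x * f y = f (X.lact x y) * f (X.ract x y)) : X.StructureGroup →* H :=
  PresentedGroup.toGroup (f := f) (by
    rintro _ ⟨x, y, u, v, h, rfl⟩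
    have := hf x y
    rw [lact, ract, h] at this
    simp [this])

theorem lift_ι {H : Type*} [Group H] (f : X.carrier → H)
    (hf : ∀ x y, f x * f y = f (X.lact x y) * f (X.ract x y)) (x : X.carrier) :
    lift f hf (X.ι x) = f x := by
  simp [lift, ι]

theorem structureGroup_induction {P : X.StructureGroup → Prop} (one : P 1)
    (gen : ∀ x, P (X.ι x)) (mul : ∀ g h, P g → P h → P (g * h)) (inv : ∀ g, P g → P g⁻¹)
    (g : X.StructureGroup) : P g := by
  induction g using PresentedGroup.induction_on with
  | _ w =>
    induction w using FreeGroup.induction_on with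
    | C1 => exact one
    | of x => exact gen x
    | inv_of x h => exact inv _ h
    | mul a b ha hb => simpa using mul _ _ ha hb

theorem ybe1 (x y z : X.carrier) :
    X.lact (X.lact x y) (X.lact (X.ract x y) z) = X.lact x (X.lact y z) := by
  have h := congrArg Prod.fst (congrFun X.yangBaxter.braid (x, y, z))
  exact h

theorem ybe2 (x y z : X.carrier) :
    X.ract (X.lact x y) (X.lact (X.ract x y) z) = X.lact (X.ract x (X.lact y z)) (X.ract y z) :=
  congrArg (fun t => t.2.1) (congrFun X.yangBaxter.braid (x, y, z))

theorem ybe3 (x y z : X.carrier) :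
    X.ract (X.ract x y) z = X.ract (X.ract x (X.lact y z)) (X.ract y z) :=
  congrArg (fun t => t.2.2) (congrFun X.yangBaxter.braid (x, y, z))

end BraidedSet

/-- The wreath product of a group `G` with the permutations of a set `S`, the product being
`(f, p) (g, q) = (s ↦ f s * g (p s), q ∘ p)`. -/
@[ext]
structure Wreath (S G : Type u) : Type u where
  fn : S → G
  perm : Equiv.Perm S

instance {S G : Type u} [Group G] : Group (Wreath S G) :=
  letI : Mul (Wreath S G) := ⟨fun a b => ⟨fun s => a.fn s * b.fn (a.perm s), b.perm * a.perm⟩⟩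
  letI : One (Wreath S G) := ⟨⟨fun _ => 1, 1⟩⟩
  letI : Inv (Wreath S G) := ⟨fun a => ⟨fun s => (a.fn (a.perm⁻¹ s))⁻¹, a.perm⁻¹⟩⟩
  Group.ofLeftAxioms
    (fun a _ _ => Wreath.ext (funext fun s => mul_assoc (a.fn s) _ _) (mul_assoc _ _ _).symm)
    (fun a => Wreath.ext (funext fun s => one_mul (a.fn s)) (mul_one _))
    (fun a => Wreath.ext (funext fun s => inv_mul_cancel (a.fn (a.perm⁻¹ s)))
      (mul_inv_cancel _))

theorem Wreath.mul_fn {S G : Type u} [Group G] (a b : Wreath S G) (s : S) :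
    (a * b).fn s = a.fn s * b.fn (a.perm s) := rfl

theorem Wreath.mul_perm {S G : Type u} [Group G] (a b : Wreath S G) (s : S) :
    (a * b).perm s = b.perm (a.perm s) := rfl

namespace BraidedSet

variable {X : BraidedSet.{u}}

/-- The two actions of `X` and `G_X` on each other, in one homomorphism: a generator `y` is sent
to `(x ↦ x ⇀ y, x ↦ x ↼ y)`. -/
noncomputable def actHom : X.StructureGroup →* Wreath X.carrier X.StructureGroup :=
  lift (fun y => ⟨fun x => X.ι (X.lact x y),
      Equiv.ofBijective (fun x => X.ract x y) (X.nondegenerate.right y)⟩) (by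
    intro y z
    ext x
    · change X.ι (X.lact x y) * X.ι (X.lact (X.ract x y) z) =
        X.ι (X.lact x (X.lact y z)) * X.ι (X.lact (X.ract x (X.lact y z)) (X.ract y z))
      rw [ι_mul, ybe1, ybe2]
    · exact ybe3 x y z)

/-- `x ⇀ g` for `x ∈ X`, `g ∈ G_X`. -/
noncomputable def xl (x : X.carrier) (g : X.StructureGroup) : X.StructureGroup :=
  (actHom g).fn x

/-- `x ↼ g` for `x ∈ X`, `g ∈ G_X`. -/
noncomputable def xr (x : X.carrier) (g : X.StructureGroup) : X.carrier := (actHom g).perm x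

theorem xl_ι (x y : X.carrier) : xl x (X.ι y) = X.ι (X.lact x y) := by
  rw [xl, actHom, lift_ι]

theorem xr_ι (x y : X.carrier) : xr x (X.ι y) = X.ract x y := by
  rw [xr, actHom, lift_ι]; rfl

theorem xl_one (x : X.carrier) : xl x 1 = 1 := by rw [xl, map_one]; rfl

theorem xr_one (x : X.carrier) : xr x 1 = x := by rw [xr, map_one]; rfl

theorem xl_mul (x : X.carrier) (g h : X.StructureGroup) :
    xl x (g * h) = xl x g * xl (xr x g) h := by rw [xl, map_mul]; rfl

theorem xr_mul (x : X.carrier) (g h : X.StructureGroup) :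
    xr x (g * h) = xr (xr x g) h := by rw [xr, map_mul]; rfl

theorem xr_xr_inv (x : X.carrier) (g : X.StructureGroup) : xr (xr x g) g⁻¹ = x := by
  rw [← xr_mul, mul_inv_cancel, xr_one]

theorem xr_inv_xr (x : X.carrier) (g : X.StructureGroup) : xr (xr x g⁻¹) g = x := by
  rw [← xr_mul, inv_mul_cancel, xr_one]

theorem xl_xr_inv (x : X.carrier) (g : X.StructureGroup) : xl (xr x g) g⁻¹ = (xl x g)⁻¹ := by
  have h := xl_mul x g g⁻¹
  rw [mul_inv_cancel, xl_one] at h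
  exact eq_inv_of_mul_eq_one_right h.symm

theorem xl_mul_xr (x : X.carrier) (g : X.StructureGroup) :
    xl x g * X.ι (xr x g) = X.ι x * g := by
  induction g using structureGroup_induction generalizing x with
  | one => rw [xl_one, xr_one, one_mul, mul_one]
  | gen y => rw [xl_ι, xr_ι, ← ι_mul]
  | mul g h hg hh => rw [xl_mul, xr_mul, mul_assoc, hh, ← mul_assoc, hg, mul_assoc]
  | inv g hg =>
    obtain ⟨x, rfl⟩ : ∃ x', xr x' g = x := ⟨_, xr_inv_xr x g⟩
    rw [xl_xr_inv, xr_xr_inv, inv_mul_eq_iff_eq_mul, ← mul_assoc, hg, mul_inv_cancel_right]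

theorem xl_surjective (x : X.carrier) : Function.Surjective (xl x) := by
  have main : ∀ g : X.StructureGroup,
      (∀ x : X.carrier, ∃ h, xl x h = g) ∧ ∀ x : X.carrier, ∃ h, xl x h = g⁻¹ := by
    intro g
    induction g using structureGroup_induction with
    | one => exact ⟨fun x => ⟨1, xl_one x⟩, fun x => ⟨1, by rw [xl_one, inv_one]⟩⟩
    | gen y =>
      refine ⟨fun x => ?_, fun x => ?_⟩
      · obtain ⟨z, hz⟩ := (X.nondegenerate.left x).2 y
        exact ⟨X.ι z, by rw [xl_ι]; exact congrArg X.ι hz⟩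
      · obtain ⟨⟨w, z⟩, hwz⟩ := X.yangBaxter.bijective.2 (y, x)
        have h1 : X.lact w z = y := congrArg Prod.fst hwz
        have h2 : X.ract w z = x := congrArg Prod.snd hwz
        refine ⟨(X.ι z)⁻¹, ?_⟩
        rw [← h2, ← xr_ι, xl_xr_inv, xl_ι, h1]
    | mul a b ha hb =>
      refine ⟨fun x => ?_, fun x => ?_⟩
      · obtain ⟨h, hh⟩ := ha.1 x
        obtain ⟨k, hk⟩ := hb.1 (xr x h)
        exact ⟨h * k, by rw [xl_mul, hh, hk]⟩
      · obtain ⟨h, hh⟩ := hb.2 x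
        obtain ⟨k, hk⟩ := ha.2 (xr x h)
        exact ⟨h * k, by rw [xl_mul, hh, hk, mul_inv_rev]⟩
    | inv a ha => exact ⟨ha.2, by simpa using ha.1⟩
  exact fun g => (main g).1 x

/-- `φ_x⁻¹ y`. -/
noncomputable def lactInv (x y : X.carrier) : X.carrier :=
  (Equiv.ofBijective (X.lact x) (X.nondegenerate.left x)).symm y

theorem lact_lactInv (x y : X.carrier) : X.lact x (lactInv x y) = y :=
  Equiv.ofBijective_apply_symm_apply (X.lact x) (X.nondegenerate.left x) y

theorem lactInv_lact (x y : X.carrier) : lactInv x (X.lact x y) = y :=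
  (X.nondegenerate.left x).1 (lact_lactInv x _)

theorem ract_lactInv_bijective (y : X.carrier) :
    Function.Bijective (fun x => X.ract x (lactInv x y)) := by
  constructor
  · intro x x' h
    have : X.R (x, lactInv x y) = X.R (x', lactInv x' y) :=
      Prod.ext ((lact_lactInv x y).trans (lact_lactInv x' y).symm) h
    exact congrArg Prod.fst (X.yangBaxter.bijective.1 this)
  · intro w
    obtain ⟨⟨x, z⟩, h⟩ := X.yangBaxter.bijective.2 (y, w)
    have h1 : X.lact x z = y := congrArg Prod.fst h
    have h2 : X.ract x z = w := congrArg Prod.snd h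
    exact ⟨x, by simp only [← h1, lactInv_lact, h2]⟩

/-- The analogue of `actHom` for the inverses of the maps `x ⇀ ·`. -/
noncomputable def invHom : X.StructureGroup →* Wreath X.carrier X.StructureGroup :=
  lift (fun y => ⟨fun x => X.ι (lactInv x y),
      Equiv.ofBijective (fun x => X.ract x (lactInv x y)) (ract_lactInv_bijective y)⟩) (by
    intro y z
    have key : ∀ x : X.carrier, ∃ a b : X.carrier, y = X.lact x a ∧ z = X.lact (X.ract x a) b :=
      fun x => ⟨lactInv x y, lactInv (X.ract x (lactInv x y)) z, (lact_lactInv _ _).symm,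
        (lact_lactInv _ _).symm⟩
    ext x
    · obtain ⟨a, b, rfl, rfl⟩ := key x
      change X.ι (lactInv x (X.lact x a)) * X.ι (lactInv (X.ract x (lactInv x (X.lact x a))) _) =
        X.ι (lactInv x _) * X.ι (lactInv (X.ract x (lactInv x _)) _)
      rw [ybe1, ybe2]
      simp only [lactInv_lact]
      exact ι_mul a b
    · obtain ⟨a, b, rfl, rfl⟩ := key x
      change X.ract (X.ract x (lactInv x (X.lact x a)))
          (lactInv (X.ract x (lactInv x (X.lact x a))) _) =
        X.ract (X.ract x (lactInv x _)) (lactInv (X.ract x (lactInv x _)) _)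
      rw [ybe1, ybe2]
      simp only [lactInv_lact]
      exact ybe3 x a b)

theorem invHom_xl (x : X.carrier) (g : X.StructureGroup) :
    (invHom (xl x g)).fn x = g ∧ (invHom (xl x g)).perm x = xr x g := by
  induction g using structureGroup_induction generalizing x with
  | one => rw [xl_one, xr_one, map_one]; exact ⟨rfl, rfl⟩
  | gen y =>
    rw [xl_ι, xr_ι, invHom, lift_ι]
    exact ⟨congrArg X.ι (lactInv_lact x y), congrArg (X.ract x) (lactInv_lact x y)⟩
  | mul g h hg hh =>
    rw [xl_mul, xr_mul, map_mul, Wreath.mul_fn, Wreath.mul_perm, (hg x).1, (hg x).2,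
      (hh _).1, (hh _).2]
    exact ⟨rfl, rfl⟩
  | inv g hg =>
    obtain ⟨x, rfl⟩ : ∃ x', xr x' g = x := ⟨_, xr_inv_xr x g⟩
    have e := map_mul invHom (xl x g) (xl x g)⁻¹
    rw [mul_inv_cancel, map_one] at e
    have e1 := congrArg (fun w => w.fn x) e
    have e2 := congrArg (fun w => w.perm x) e
    simp only [Wreath.mul_fn, Wreath.mul_perm, (hg x).1, (hg x).2] at e1 e2
    rw [xl_xr_inv, xr_xr_inv]
    exact ⟨eq_inv_of_mul_eq_one_right e1.symm, e2.symm⟩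

theorem xl_bijective (x : X.carrier) : Function.Bijective (xl x) :=
  ⟨Function.LeftInverse.injective (g := fun g => (invHom g).fn x) (fun g => (invHom_xl x g).1),
    xl_surjective x⟩

theorem x_rel (x y : X.carrier) (g : X.StructureGroup) :
    xl x (xl y g) = xl (X.lact x y) (xl (X.ract x y) g) ∧
    X.lact (xr x (xl y g)) (xr y g) = xr (X.lact x y) (xl (X.ract x y) g) ∧
    X.ract (xr x (xl y g)) (xr y g) = xr (X.ract x y) g := by
  induction g using structureGroup_induction generalizing x y with
  | one => simp [xl_one, xr_one]
  | gen z =>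
    simp only [xl_ι, xr_ι]
    exact ⟨congrArg X.ι (ybe1 x y z).symm, (ybe2 x y z).symm, (ybe3 x y z).symm⟩
  | mul g h hg hh =>
    obtain ⟨g1, g2, g3⟩ := hg x y
    obtain ⟨h1, h2, h3⟩ := hh (xr x (xl y g)) (xr y g)
    rw [g2, g3] at h1 h2
    rw [g3] at h3
    simp only [xl_mul, xr_mul]
    exact ⟨by rw [g1, h1], h2, h3⟩
  | inv g hg =>
    obtain ⟨y, rfl⟩ : ∃ y', xr y' g = y := ⟨_, xr_inv_xr y g⟩
    obtain ⟨x, rfl⟩ : ∃ x', xr x' (xl y g) = x := ⟨_, xr_inv_xr x _⟩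
    obtain ⟨g1, g2, g3⟩ := hg x y
    rw [g2, g3]
    simp only [xl_xr_inv, xr_xr_inv, g1, and_self]

/-- The two actions of `G_X` on itself, in one homomorphism: a generator `x` is sent to
`(g ↦ x ↼ g, g ↦ x ⇀ g)`. -/
noncomputable def fullHom :
    X.StructureGroup →* (Wreath X.StructureGroup X.StructureGroupᵐᵒᵖ)ᵐᵒᵖ :=
  lift (fun x => MulOpposite.op ⟨fun g => MulOpposite.op (X.ι (xr x g)),
      Equiv.ofBijective (xl x) (xl_bijective x)⟩) (by
    intro x y
    apply MulOpposite.unop_injective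
    ext g
    · apply MulOpposite.unop_injective
      change X.ι (xr x (xl y g)) * X.ι (xr y g) =
        X.ι (xr (X.lact x y) (xl (X.ract x y) g)) * X.ι (xr (X.ract x y) g)
      rw [ι_mul, (x_rel x y g).2.1, (x_rel x y g).2.2]
    · exact (x_rel x y g).1)

/-- `a ⇀ g` for `a, g ∈ G_X`. -/
noncomputable def gl (a g : X.StructureGroup) : X.StructureGroup := (fullHom a).unop.perm g

/-- `a ↼ g` for `a, g ∈ G_X`. -/
noncomputable def gr (a g : X.StructureGroup) : X.StructureGroup :=
  ((fullHom a).unop.fn g).unop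

theorem gl_ι (x : X.carrier) (g : X.StructureGroup) : gl (X.ι x) g = xl x g := by
  rw [gl, fullHom, lift_ι]; rfl

theorem gr_ι (x : X.carrier) (g : X.StructureGroup) : gr (X.ι x) g = X.ι (xr x g) := by
  rw [gr, fullHom, lift_ι]; rfl

theorem one_gl (g : X.StructureGroup) : gl 1 g = g := by rw [gl, map_one]; rfl

theorem one_gr (g : X.StructureGroup) : gr 1 g = 1 := by rw [gr, map_one]; rfl

theorem mul_gl (a b g : X.StructureGroup) : gl (a * b) g = gl a (gl b g) := by
  rw [gl, map_mul]; rfl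

theorem mul_gr (a b g : X.StructureGroup) : gr (a * b) g = gr a (gl b g) * gr b g := by
  rw [gr, map_mul]; rfl

theorem inv_gl_gl (a g : X.StructureGroup) : gl a⁻¹ (gl a g) = g := by
  rw [← mul_gl, inv_mul_cancel, one_gl]

theorem gl_inv_gl (a g : X.StructureGroup) : gl a (gl a⁻¹ g) = g := by
  rw [← mul_gl, mul_inv_cancel, one_gl]

theorem inv_gr_gl (a g : X.StructureGroup) : gr a⁻¹ (gl a g) = (gr a g)⁻¹ := by
  have h := mul_gr a⁻¹ a g
  rw [inv_mul_cancel, one_gr] at h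
  exact eq_inv_of_mul_eq_one_left h.symm

theorem gl_one (a : X.StructureGroup) : gl a 1 = 1 := by
  induction a using structureGroup_induction with
  | one => exact one_gl 1
  | gen x => rw [gl_ι, xl_one]
  | mul a b ha hb => rw [mul_gl, hb, ha]
  | inv a ha =>
    have h := inv_gl_gl a 1
    rwa [ha] at h

theorem gr_one (a : X.StructureGroup) : gr a 1 = a := by
  induction a using structureGroup_induction with
  | one => exact one_gr 1
  | gen x => rw [gr_ι, xr_one]
  | mul a b ha hb => rw [mul_gr, gl_one, hb, ha]
  | inv a ha =>
    have h := inv_gr_gl a 1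
    rwa [gl_one, ha] at h

theorem gl_mul (a h k : X.StructureGroup) : gl a (h * k) = gl a h * gl (gr a h) k := by
  induction a using structureGroup_induction generalizing h k with
  | one => rw [one_gr, one_gl, one_gl, one_gl]
  | gen x => rw [gl_ι, gl_ι, gr_ι, gl_ι, xl_mul]
  | mul a b ha hb => rw [mul_gl, hb, ha, mul_gl, mul_gr, mul_gl]
  | inv a ha =>
    obtain ⟨h, rfl⟩ : ∃ h', gl a h' = h := ⟨_, gl_inv_gl a h⟩
    obtain ⟨k, rfl⟩ : ∃ k', gl (gr a h) k' = k := ⟨_, gl_inv_gl _ k⟩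
    rw [← ha, inv_gl_gl, inv_gl_gl, inv_gr_gl, inv_gl_gl]

theorem gr_gr (a h k : X.StructureGroup) : gr (gr a h) k = gr a (h * k) := by
  induction a using structureGroup_induction generalizing h k with
  | one => rw [one_gr, one_gr, one_gr]
  | gen x => rw [gr_ι, gr_ι, gr_ι, xr_mul]
  | mul a b ha hb => rw [mul_gr, mul_gr, mul_gr, ha, hb, gl_mul]
  | inv a ha =>
    obtain ⟨h, rfl⟩ : ∃ h', gl a h' = h := ⟨_, gl_inv_gl a h⟩
    obtain ⟨k, rfl⟩ : ∃ k', gl (gr a h) k' = k := ⟨_, gl_inv_gl _ k⟩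
    rw [inv_gr_gl, inv_gr_gl, ha, ← gl_mul, inv_gr_gl]

theorem gl_mul_gr (a g : X.StructureGroup) : gl a g * gr a g = a * g := by
  induction a using structureGroup_induction generalizing g with
  | one => rw [one_gl, one_gr, mul_one, one_mul]
  | gen x => rw [gl_ι, gr_ι, xl_mul_xr]
  | mul a b ha hb => rw [mul_gl, mul_gr, ← mul_assoc, ha, mul_assoc, hb, mul_assoc]
  | inv a ha =>
    obtain ⟨g, rfl⟩ : ∃ g', gl a g' = g := ⟨_, gl_inv_gl a g⟩
    rw [inv_gl_gl, inv_gr_gl, eq_inv_mul_iff_mul_eq, ← mul_assoc, ← ha, mul_inv_cancel_right]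

variable (X) in
/-- The structure group `G_X` with the braiding that extends `R`. -/
noncomputable def structureBraidedGroup : BraidedGroup.{u} where
  carrier := X.StructureGroup
  σ p := (gl p.1 p.2, gr p.1 p.2)
  braiding :=
    { matched :=
        { one_left := one_gl
          left_left := fun a b h => (mul_gl a b h).symm
          mul_right := mul_gr
          right_one := gr_one
          right_right := gr_gr
          left_mul := gl_mul }
      mul_eq := gl_mul_gr }

/-- The braiding of `G_X` extends `R`. -/
theorem structureBraidedGroup_extends (x y : X.carrier) :
    (X.structureBraidedGroup).σ (X.ι x, X.ι y) = Prod.map X.ι X.ι (X.R (x, y)) := by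
  change (gl (X.ι x) (X.ι y), gr (X.ι x) (X.ι y)) = _
  rw [gl_ι, gr_ι, xl_ι, xr_ι]; rfl

variable {Y : BraidedSet.{u}}

theorem Hom.map_lact (f : BraidedSet.Hom X Y) (x y : X.carrier) :
    f.toFun (X.lact x y) = Y.lact (f.toFun x) (f.toFun y) :=
  congrArg Prod.fst (congrFun f.comm (x, y))

theorem Hom.map_ract (f : BraidedSet.Hom X Y) (x y : X.carrier) :
    f.toFun (X.ract x y) = Y.ract (f.toFun x) (f.toFun y) :=
  congrArg Prod.snd (congrFun f.comm (x, y))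

/-- The homomorphism `G_X → G_Y` induced by a homomorphism `X → Y`. -/
def Hom.groupHom (f : BraidedSet.Hom X Y) : X.StructureGroup →* Y.StructureGroup :=
  lift (fun x => Y.ι (f.toFun x)) (fun x y => by rw [f.map_lact, f.map_ract, ι_mul])

theorem Hom.groupHom_ι (f : BraidedSet.Hom X Y) (x : X.carrier) :
    f.groupHom (X.ι x) = Y.ι (f.toFun x) := lift_ι _ _ x

theorem Hom.groupHom_lact (f : BraidedSet.Hom X Y) (x y : X.carrier) :
    f.groupHom (X.ι (X.lact x y)) = gl (f.groupHom (X.ι x)) (f.groupHom (X.ι y)) := by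
  rw [f.groupHom_ι, f.groupHom_ι, f.groupHom_ι, gl_ι, xl_ι, f.map_lact]

theorem Hom.groupHom_ract (f : BraidedSet.Hom X Y) (x y : X.carrier) :
    f.groupHom (X.ι (X.ract x y)) = gr (f.groupHom (X.ι x)) (f.groupHom (X.ι y)) := by
  rw [f.groupHom_ι, f.groupHom_ι, f.groupHom_ι, gr_ι, xr_ι, f.map_ract]

/-- A homomorphism `f` from `G_X` to a braided group commutes with the braidings as soon as
it does so on generators. -/
theorem comm_of_ι {G : BraidedGroup.{u}} (f : X.StructureGroup →* G.carrier)
    (hl : ∀ x y, f (X.ι (X.lact x y)) = G.lact (f (X.ι x)) (f (X.ι y)))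
    (hr : ∀ x y, f (X.ι (X.ract x y)) = G.ract (f (X.ι x)) (f (X.ι y))) :
    Prod.map f f ∘ (X.structureBraidedGroup).σ = G.σ ∘ Prod.map f f := by
  have hx : ∀ (g : X.StructureGroup) (x : X.carrier),
      f (xl x g) = G.lact (f (X.ι x)) (f g) ∧
      f (X.ι (xr x g)) = G.ract (f (X.ι x)) (f g) := by
    intro g
    induction g using structureGroup_induction with
    | one =>
      intro x
      rw [xl_one, xr_one, map_one, BraidedGroup.lact_one, BraidedGroup.ract_one]
      exact ⟨rfl, rfl⟩
    | gen y => intro x; rw [xl_ι, xr_ι]; exact ⟨hl x y, hr x y⟩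
    | mul g h hg hh =>
      intro x
      rw [xl_mul, xr_mul, map_mul, map_mul, (hg x).1, (hh _).1, (hh _).2, (hg x).2,
        BraidedGroup.lact_mul, BraidedGroup.ract_ract]
      exact ⟨rfl, rfl⟩
    | inv g hg =>
      intro x
      obtain ⟨x, rfl⟩ : ∃ x', xr x' g = x := ⟨_, xr_inv_xr x g⟩
      have e := BraidedGroup.lact_mul (f (X.ι x)) (f g) (f g)⁻¹
      rw [mul_inv_cancel, BraidedGroup.lact_one] at e
      rw [xl_xr_inv, xr_xr_inv, map_inv, map_inv, (hg x).1, (hg x).2,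
        BraidedGroup.ract_ract_inv]
      exact ⟨(eq_inv_of_mul_eq_one_right e.symm).symm, rfl⟩
  have ha : ∀ a g : X.StructureGroup,
      f (gl a g) = G.lact (f a) (f g) ∧ f (gr a g) = G.ract (f a) (f g) := by
    intro a
    induction a using structureGroup_induction with
    | one =>
      intro g
      rw [one_gl, one_gr, map_one, BraidedGroup.one_lact, BraidedGroup.one_ract]
      exact ⟨rfl, rfl⟩
    | gen x => intro g; rw [gl_ι, gr_ι]; exact hx g x
    | mul a b ha hb =>
      intro g
      rw [mul_gl, mul_gr, map_mul, map_mul, (ha _).1, (ha _).2, (hb g).1, (hb g).2,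
        BraidedGroup.lact_lact, BraidedGroup.mul_ract]
      exact ⟨rfl, rfl⟩
    | inv a ha =>
      intro g
      obtain ⟨g, rfl⟩ : ∃ g', gl a g' = g := ⟨_, gl_inv_gl a g⟩
      rw [inv_gl_gl, inv_gr_gl, map_inv, map_inv, (ha g).1, (ha g).2,
        BraidedGroup.inv_lact_lact, BraidedGroup.inv_ract_lact]
      exact ⟨rfl, rfl⟩
  funext p
  exact Prod.ext (ha p.1 p.2).1 (ha p.1 p.2).2

/-- The braiding of `G_X` is the only one that extends `R`. -/
theorem structureBraidedGroup_unique
    (σ : X.StructureGroup × X.StructureGroup → X.StructureGroup × X.StructureGroup)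
    (hσ : IsBraiding σ) (h : ∀ x y, σ (X.ι x, X.ι y) = Prod.map X.ι X.ι (X.R (x, y))) :
    (X.structureBraidedGroup).σ = σ :=
  comm_of_ι (G := ⟨X.StructureGroup, σ, hσ⟩) (MonoidHom.id _)
    (fun x y => (congrArg Prod.fst (h x y)).symm) (fun x y => (congrArg Prod.snd (h x y)).symm)

theorem hom_ext {H : Type*} [Group H] {f g : X.StructureGroup →* H}
    (h : ∀ x, f (X.ι x) = g (X.ι x)) : f = g :=
  PresentedGroup.ext h

end BraidedSet

/-- The structure group functor from non-degenerate braided sets to braided groups. -/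
noncomputable def structureGroupFunctor : BraidedSet.{u} ⥤ BraidedGroup.{u} where
  obj X := X.structureBraidedGroup
  map {X Y} f :=
    { toHom := BraidedSet.Hom.groupHom f
      comm := BraidedSet.comm_of_ι (G := Y.structureBraidedGroup) (BraidedSet.Hom.groupHom f)
        (BraidedSet.Hom.groupHom_lact f) (BraidedSet.Hom.groupHom_ract f) }
  map_id X := BraidedGroup.Hom.ext (BraidedSet.hom_ext fun x => BraidedSet.Hom.groupHom_ι _ x)
  map_comp {X Y Z} f g := BraidedGroup.Hom.ext (BraidedSet.hom_ext fun x => by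
    change BraidedSet.Hom.groupHom _ _ =
      BraidedSet.Hom.groupHom g (BraidedSet.Hom.groupHom f (X.ι x))
    rw [BraidedSet.Hom.groupHom_ι, BraidedSet.Hom.groupHom_ι, BraidedSet.Hom.groupHom_ι]
    rfl)

end BraidedPost

namespace BraidedPost

/-! The adjunction is the composite of two others, `structureGroupFunctor` ⊣ `forgetBraided` and
`braidedToPost` ⊣ `postToBraided`. Each is given by a natural bijection of hom-sets.

The first is the universal property of `G_X`. In a braided group `(a ⇀ b)(a ↼ b) = ab`, so a
morphism of braided sets `X → G` respects the defining relations of `G_X` and extends uniquely to a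
group homomorphism `G_X → G`. That this extension commutes with the braidings is `comm_of_ι`: the
axioms of a braided group determine both actions on products and inverses from their values on
generators. The inverse bijection is restriction along `ι`, because homomorphisms out of `G_X` that
agree on `X` are equal (`hom_ext`).

The second bijection leaves the underlying map unchanged. Let `f` go from a braided group to a
post-group and carry `⇀` to `▷`. Since `a ∘ b = a · (a ⇀ b)` and `a ⇀ _` is bijective, `f` respects
`∘` exactly when it respects `·`. Compatibility with `↼` then comes for free, since `a ↼ b = (a ⇀
b)† ∘ a ∘ b`. -/

/-! ### The universal property of the structure group -/

theorem BraidedSet.Hom.map_rel {X : BraidedSet.{u}} {G : BraidedGroup.{u}}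
    (f : BraidedSet.Hom X (forgetBraided.obj G)) (x y : X.carrier) :
    letI F : X.carrier → G.carrier := f.toFun
    F x * F y = F (X.lact x y) * F (X.ract x y) := by
  rw [f.map_lact, f.map_ract]
  -- Once `f` is moved past `⇀` and `↼`, the relation is the axiom `(a ⇀ b)(a ↼ b) = ab` in `G`.
  exact (BraidedGroup.lact_mul_ract _ _).symm

/-- The homomorphism of braided groups `G_X → G` that extends a homomorphism of braided sets
`X → G`. -/
noncomputable def BraidedSet.Hom.liftHom {X : BraidedSet.{u}} {G : BraidedGroup.{u}}
    (f : BraidedSet.Hom X (forgetBraided.obj G)) :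
    BraidedGroup.Hom X.structureBraidedGroup G :=
  -- `f` takes values in a bare braided set; `F` is the same map with values in the group `G`, where
  -- products make sense.
  let F : X.carrier → G.carrier := f.toFun
  have hl : ∀ x y, F (X.lact x y) = G.lact (F x) (F y) := f.map_lact
  have hr : ∀ x y, F (X.ract x y) = G.ract (F x) (F y) := f.map_ract
  { toHom := BraidedSet.lift F f.map_rel
    comm := BraidedSet.comm_of_ι _
      (fun x y => by simp only [BraidedSet.lift_ι]; exact hl x y)
      (fun x y => by simp only [BraidedSet.lift_ι]; exact hr x y) }

/-- The value on generators is all that the adjunction needs to know about the extension: both round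
trips and naturality reduce to it. -/
theorem BraidedSet.Hom.liftHom_ι {X : BraidedSet.{u}} {G : BraidedGroup.{u}}
    (f : BraidedSet.Hom X (forgetBraided.obj G)) (x : X.carrier) :
    f.liftHom.toHom (X.ι x) = f.toFun x :=
  BraidedSet.lift_ι (H := G.carrier) f.toFun f.map_rel x

/-- The restriction of a homomorphism of braided groups `G_X → G` to `X`. -/
noncomputable def BraidedGroup.Hom.restrict {X : BraidedSet.{u}} {G : BraidedGroup.{u}}
    (f : BraidedGroup.Hom X.structureBraidedGroup G) :
    BraidedSet.Hom X (forgetBraided.obj G) where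
  toFun x := f.toHom (X.ι x)
  comm := funext fun p => by
    -- On a pair of generators the braiding of `G_X` is `R`, so compatibility with braidings
    -- specializes to compatibility with `R`.
    have h := congrFun f.comm (X.ι p.1, X.ι p.2)
    simp only [Function.comp_apply, BraidedSet.structureBraidedGroup_extends] at h
    exact h

/-- The structure group functor is left adjoint to the forgetful functor. -/
noncomputable def structureGroupAdjunction :
    structureGroupFunctor.{u} ⊣ forgetBraided.{u} :=
  Adjunction.mkOfHomEquiv
    { homEquiv := fun _ _ =>
        { toFun := BraidedGroup.Hom.restrict
          invFun := BraidedSet.Hom.liftHom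
          left_inv := fun f => BraidedGroup.Hom.ext
            (BraidedSet.hom_ext fun x => BraidedSet.Hom.liftHom_ι _ x)
          right_inv := fun f => BraidedSet.Hom.ext
            (funext fun x => BraidedSet.Hom.liftHom_ι f x) }
      -- Both sides are homomorphisms out of `G_X`, and both send the generator of `x` to `g (f x)`.
      homEquiv_naturality_left_symm := fun f g => BraidedGroup.Hom.ext
        (BraidedSet.hom_ext fun x => by
          refine (BraidedSet.Hom.liftHom_ι _ x).trans ?_
          change _ = (BraidedSet.Hom.liftHom g).toHom (BraidedSet.Hom.groupHom f (BraidedSet.ι _ x))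
          rw [BraidedSet.Hom.groupHom_ι, BraidedSet.Hom.liftHom_ι]
          rfl)
      -- Restriction is precomposition with `ι`, which commutes with postcomposition by definition.
      homEquiv_naturality_right := fun _ _ => rfl }

/-! ### Braided groups and post-groups have the same morphisms -/

/-- A homomorphism of post-groups out of the post-group of a braided group, as a homomorphism
of braided groups. -/
noncomputable def PostGroup.Hom.toBraided {B : BraidedGroup.{u}} {G : PostGroup.{u}}
    (f : PostGroup.Hom (braidedToPost.obj B) G) : BraidedGroup.Hom B (postToBraided.obj G) :=
  -- `G` carries two group structures. Products and inverses written on it below are those of `∘`,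
  -- so the inverse in `h2` is `†`; the product `·` enters only through `circ` and `f.map_mul`.
  letI := G.subAdjacent
  have hl : ∀ a b : B.carrier, f.toFun (B.lact a b) = G.rhd (f.toFun a) (f.toFun b) := f.map_rhd
  have hm : ∀ a b : B.carrier, f.toFun (a * b) = G.circ (f.toFun a) (f.toFun b) := fun a b => by
    rw [PostGroup.circ, ← hl, ← BraidedGroup.dot_lact]
    exact f.map_mul a (B.lact a b)
  let F : B.carrier →* G.carrier := MonoidHom.mk' f.toFun hm
  { toHom := F
    comm := funext fun p => by
      -- The second component of a braiding is determined by the first and the product, so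
      -- preserving these two is enough.
      have h2 : F (B.ract p.1 p.2) = (G.rhd (F p.1) (F p.2))⁻¹ * F p.1 * F p.2 := by
        have h : F (B.lact p.1 p.2) = G.rhd (F p.1) (F p.2) := hl p.1 p.2
        rw [mul_assoc, ← _root_.map_mul F, ← BraidedGroup.lact_mul_ract,
          _root_.map_mul, h,
          inv_mul_cancel_left]
      exact Prod.ext (hl p.1 p.2) h2 }

/-- A homomorphism of braided groups to the braided group of a post-group, as a homomorphism
of post-groups. -/
noncomputable def BraidedGroup.Hom.toPost {B : BraidedGroup.{u}} {G : PostGroup.{u}}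
    (f : BraidedGroup.Hom B (postToBraided.obj G)) : PostGroup.Hom (braidedToPost.obj B) G :=
  let F : B.carrier → G.carrier := f.toHom
  have hl : ∀ a b, F (B.lact a b) = G.rhd (F a) (F b) :=
    fun a b => congrArg Prod.fst (congrFun f.comm (a, b))
  -- Multiplicativity of `f` concerns `∘` on the target, which unfolds to this formula in the
  -- product `·` of `G`.
  have hm : ∀ a b, F (a * b) = F a * G.rhd (F a) (F b) := map_mul f.toHom
  { toFun := F
    map_mul := fun (a b : B.carrier) => by
      change F (BraidedGroup.dot a b) = F a * F b
      -- With `b = a ⇀ c`, the product `a · b` becomes `a ∘ c`, to which `hm` applies.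
      obtain ⟨c, rfl⟩ : ∃ c, B.lact a c = b := ⟨_, BraidedGroup.lact_inv_lact a b⟩
      rw [hl, ← hm, BraidedGroup.dot_lact]
    map_rhd := hl }

/-- The functor from braided groups to post-groups is left adjoint to the functor from
post-groups to braided groups. -/
noncomputable def braidedToPostAdjunction : braidedToPost.{u} ⊣ postToBraided.{u} :=
  Adjunction.mkOfHomEquiv
    { homEquiv := fun _ _ =>
        { toFun := PostGroup.Hom.toBraided
          invFun := BraidedGroup.Hom.toPost
          -- Neither passage changes the underlying map, so the round trips and both naturality
          -- squares hold by definition.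
          left_inv := fun _ => rfl
          right_inv := fun _ => rfl }
      homEquiv_naturality_left_symm := fun _ _ => rfl
      homEquiv_naturality_right := fun _ _ => rfl }

end BraidedPost

/-- Adjunctions compose: the left adjoints in one order, the right adjoints in the opposite order.
-/
theorem mainTheorem9 :
    Nonempty
      ((BraidedPost.structureGroupFunctor.{u} ⋙ BraidedPost.braidedToPost.{u}) ⊣
        (BraidedPost.postToBraided.{u} ⋙ BraidedPost.forgetBraided.{u})) :=
  ⟨BraidedPost.structureGroupAdjunction.comp BraidedPost.braidedToPostAdjunction⟩
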